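/- Let $d\ge 2$ be an integer and let $K$ be a global field (a number field or a finite extension of $\mathbb{F}_q(t)$) of characteristic not dividing $d$ that contains a primitive $d$th root of unity. Let $f(z)=z^d+c\in K[z]$, and let $g(z)\in K[z]$ divide an iterate $f^m(z)$ of $f$ for some $m\ge 0$, where $f^0(z)=z$. Suppose that there is a non-archimedean place $\mathfrak{p}$ of $K$ whose residue characteristic is prime to $d$ and such that $v_{\mathfrak{p}}(c)>0$ (with $v_{\mathfrak p}(0)=\infty$). Fix an algebraic closure $\overline K$ of $K$. For $n\ge 0$ let $T_n\subset\overline K$ be the set of roots of $g\circ f^n$, let $K_n=K(T_n)$ and $G_n=\mathrm{Gal}(K_n/K)$, let $G_\infty=\varprojlim G_n$ (with respect to restriction), with projections $\pi_n:G_\infty\to G_n$, and let $\mu$ be the Haar measure on $G_\infty$ with $\mu(G_\infty)=1$. For $\sigma\in G_\infty$ put $$Y_n(\sigma)=\#\{\beta\in T_n : \pi_n(\sigma)(\beta)=\beta\}.$$ Then the Galois process $Y_1,Y_2,\dots$ of $(f,g)$ is an eventual martingale: there is $N\ge 1$ such that $Y_n$ is integrable for all $n\ge N$ and, for all $n>N$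 and all real $t_N,\dots,t_{n-1}$ with $\mu(Y_N=t_N,\dots,Y_{n-1}=t_{n-1})>0$, $$E\left(Y_n \mid Y_N=t_N,\dots,Y_{n-1}=t_{n-1}\right)=t_{n-1}.$$ -/

import Mathlib

open Polynomial MeasureTheory

/-- A global field: a number field, or a finite extension of `𝔽_q(t)` for some finite field `𝔽_q`. -/
def IsGlobalField (K : Type*) [Field K] : Prop :=
  NumberField K ∨
    ∃ (F : Type) (_ : Field F) (_ : Finite F) (_ : Algebra (RatFunc F) K), FunctionField F K

/-- The residue characteristic of a non-archimedean valuation `v` on `K`: the characteristic of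
`{v ≤ 1} / {v < 1}`. -/
noncomputable def residueCharacteristic {K : Type*} [Field K] {Γ : Type*}
    [LinearOrderedCommGroupWithZero Γ] (v : Valuation K Γ) : ℕ :=
  ringChar (IsLocalRing.ResidueField v.valuationSubring)

namespace GaloisProcess

/-- The `n`th iterate of `f`, with `iter f 0 = z`. -/
noncomputable def iter {K : Type*} [Field K] (f : K[X]) (n : ℕ) : K[X] :=
  f.comp^[n] X

/-- `T_n`: the set of (distinct) roots of `g ∘ f^n` in the algebraic closure of `K`. -/
noncomputable def rootsAt {K : Type*} [Field K] (f g : K[X]) (n : ℕ) : Set (AlgebraicClosure K) :=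
  (g.comp (iter f n)).rootSet (AlgebraicClosure K)

/-- `K_n = K(T_n)`: the splitting field of `g ∘ f^n` inside the algebraic closure of `K`. -/
noncomputable def splitField {K : Type*} [Field K] (f g : K[X]) (n : ℕ) :
    IntermediateField K (AlgebraicClosure K) :=
  IntermediateField.adjoin K (rootsAt f g n)

instance {K : Type*} [Field K] (f g : K[X]) (n : ℕ) : FiniteDimensional K (splitField f g n) :=
  haveI : Finite (rootsAt f g n) := Polynomial.rootSet_finite _ _
  IntermediateField.finiteDimensional_adjoin fun x _ =>
    (Algebra.IsAlgebraic.isAlgebraic (R := K) x).isIntegral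

/-- `G_n = Gal(K_n / K)`. Its (Krull) topology is discrete, as `K_n / K` is finite. -/
abbrev galGroup {K : Type*} [Field K] (f g : K[X]) (n : ℕ) : Type _ :=
  Gal((splitField f g n)/K)

/-- `a ∈ G_m` and `b ∈ G_n` agree on `K_m ∩ K_n`. When `K_m ⊆ K_n`, this says that `a` is the
restriction of `b` to `K_m`. -/
def Agree {K : Type*} [Field K] {f g : K[X]} {m n : ℕ} (a : galGroup f g m) (b : galGroup f g n) :
    Prop :=
  ∀ (x : splitField f g m) (y : splitField f g n),
    (x : AlgebraicClosure K) = y → (a x : AlgebraicClosure K) = b y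

theorem Agree.pow {K : Type*} [Field K] {f g : K[X]} {m n : ℕ} {a : galGroup f g m}
    {b : galGroup f g n} (h : Agree a b) (k : ℕ) : Agree (a ^ k) (b ^ k) := by
  induction k with
  | zero => intro x y hxy; simpa using hxy
  | succ k ih =>
    intro x y hxy
    rw [pow_succ, pow_succ]
    exact ih _ _ (h x y hxy)

theorem Agree.inv {K : Type*} [Field K] {f g : K[X]} {m n : ℕ} {a : galGroup f g m}
    {b : galGroup f g n} (h : Agree a b) : Agree a⁻¹ b⁻¹ := by
  have ha : 0 < orderOf a := orderOf_pos a
  have hb : 0 < orderOf b := orderOf_pos b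
  have hN : 0 < orderOf a * orderOf b := Nat.mul_pos ha hb
  have h1 : a⁻¹ = a ^ (orderOf a * orderOf b - 1) := by
    rw [inv_eq_iff_mul_eq_one, ← pow_succ', Nat.sub_add_cancel hN, pow_mul, pow_orderOf_eq_one,
      one_pow]
  have h2 : b⁻¹ = b ^ (orderOf a * orderOf b - 1) := by
    rw [inv_eq_iff_mul_eq_one, ← pow_succ', Nat.sub_add_cancel hN, mul_comm, pow_mul,
      pow_orderOf_eq_one, one_pow]
  rw [h1, h2]
  exact h.pow _

/-- `G_∞ = lim G_n`, the inverse limit of the groups `G_n` along the restriction maps, as a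
topological subgroup of the product of the (discrete) groups `G_n`. -/
def galLimit {K : Type*} [Field K] (f g : K[X]) : Subgroup (∀ n : ℕ, galGroup f g n) where
  carrier := {σ | ∀ m n, m ≤ n → Agree (σ m) (σ n)}
  one_mem' := fun _ _ _ _ _ hxy => hxy
  mul_mem' := fun {_ _} ha hb m n hmn x y hxy => ha m n hmn _ _ (hb m n hmn x y hxy)
  inv_mem' := fun {_} ha m n hmn => (ha m n hmn).inv

/-- `Y_n(σ)`: the number of elements of `T_n` fixed by `π_n(σ)`, the component of `σ` in `G_n`. -/
noncomputable def process {K : Type*} [Field K] (f g : K[X]) (n : ℕ) (σ : galLimit f g) : ℝ :=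
  ({β : splitField f g n | (β : AlgebraicClosure K) ∈ rootsAt f g n ∧ σ.1 n β = β}.ncard : ℝ)

end GaloisProcess

/-- The process `Y 1, Y 2, …` (the value `Y 0` is ignored) is a martingale: each `Y n` is
integrable and, for `n ≥ 1` and all `t₁, …, tₙ`,
`E(Y (n+1) | Y 1 = t₁, …, Y n = tₙ) = tₙ` whenever the conditioning event has positive measure. -/
def IsMartingaleProcess {Ω : Type*} [MeasurableSpace Ω] (μ : Measure Ω) (Y : ℕ → Ω → ℝ) : Prop :=
  (∀ n, 1 ≤ n → Integrable (Y n) μ) ∧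
    ∀ n, 1 ≤ n → ∀ t : ℕ → ℝ,
      0 < μ {ω | ∀ i, 1 ≤ i → i ≤ n → Y i ω = t i} →
        ∫ ω, Y (n + 1) ω ∂(ProbabilityTheory.cond μ {ω | ∀ i, 1 ≤ i → i ≤ n → Y i ω = t i}) = t n

/-- For some `N ≥ 1`, the process `Y N, Y (N+1), Y (N+2), …` is a martingale. -/
def IsEventualMartingaleProcess {Ω : Type*} [MeasurableSpace Ω] (μ : Measure Ω)
    (Y : ℕ → Ω → ℝ) : Prop :=
  ∃ N, 1 ≤ N ∧ IsMartingaleProcess μ (fun n => Y (N - 1 + n))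

namespace Valuation

variable {K : Type*} [Field K]

/-- If every value of `v` has a fixed positive power in the cyclic group generated by `γ`, then the
value group of `v` is cyclic. -/
theorem isCyclic_valueGroup_of_pow_mem_zpowers (v : Valuation K NNReal) (γ : NNRealˣ) {n : ℕ}
    (hn : n ≠ 0) (h : ∀ x : K, x ≠ 0 → ∃ k : ℤ, v x ^ n = (γ : NNReal) ^ k) :
    IsCyclic (MonoidWithZeroHom.valueGroup (.ofClass v)) := by
  have hmem : ∀ y : MonoidWithZeroHom.valueGroup (.ofClass v),
      (y : NNRealˣ) ^ n ∈ Subgroup.zpowers γ := by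
    rintro ⟨y, hy⟩
    obtain ⟨a, ha, x, hx⟩ := (MonoidWithZeroHom.mem_valueGroup_iff_of_comm _).1 hy
    simp only [MonoidWithZeroHom.coe_ofClass] at ha hx
    have hy' : (y : NNReal) = v (x / a) := by
      rw [map_div₀, ← hx, mul_div_cancel_left₀ _ ha]
    have hxa : x / a ≠ 0 := fun h0 => by simp [h0] at hy'
    obtain ⟨k, hk⟩ := h _ hxa
    refine ⟨k, Units.ext ?_⟩
    simp only [Units.val_zpow_eq_zpow_val, Units.val_pow_eq_pow_val, hy', hk]
  let φ : MonoidWithZeroHom.valueGroup (.ofClass v) →* Subgroup.zpowers γ :=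
    { toFun := fun y => ⟨(y : NNRealˣ) ^ n, hmem y⟩
      map_one' := by ext; simp
      map_mul' := fun a b => by ext; simp [mul_pow] }
  refine isCyclic_of_injective φ fun a b hab => ?_
  have h1 : (a : NNRealˣ) ^ n = (b : NNRealˣ) ^ n := congrArg Subtype.val hab
  have h2 : ((a : NNRealˣ) : NNReal) ^ n = ((b : NNRealˣ) : NNReal) ^ n := by
    simpa using congrArg Units.val h1
  exact Subtype.ext (Units.ext ((pow_left_inj₀ zero_le zero_le hn).1 h2))

/-- In a vanishing sum whose terms do not all vanish, two terms have the same value. -/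
theorem exists_eq_of_sum_eq_zero {ι : Type*} (v : Valuation K NNReal)
    (s : Finset ι) (f : ι → K) (hf : ∀ i ∈ s, f i ≠ 0) (hs : s.Nonempty)
    (h0 : ∑ i ∈ s, f i = 0) : ∃ i ∈ s, ∃ j ∈ s, i ≠ j ∧ v (f i) = v (f j) := by
  classical
  obtain ⟨i, hi, hmax⟩ := s.exists_max_image (fun i => v (f i)) hs
  by_contra! hne
  have := v.map_sum_eq_of_lt hi fun j hj => by
    simp only [Finset.mem_sdiff, Finset.mem_singleton] at hj
    exact lt_of_le_of_ne (hmax j hj.1) (hne j hj.1 i hi hj.2)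
  rw [h0, map_zero] at this
  exact hf i hi ((v.zero_iff).1 this.symm)

theorem exists_pow_factorial_eq_zpow {K₀ : Type*} [Field K₀] [Algebra K₀ K] [FiniteDimensional K₀ K]
    (v : Valuation K NNReal) (γ : NNRealˣ)
    (h : ∀ x : K₀, x ≠ 0 → ∃ k : ℤ, v (algebraMap K₀ K x) = (γ : NNReal) ^ k) (x : K) (hx : x ≠ 0) :
    ∃ k : ℤ, v x ^ (Module.finrank K₀ K).factorial = (γ : NNReal) ^ k := by
  have hγ : (γ : NNReal) ≠ 0 := γ.ne_zero
  have hvx : v x ≠ 0 := (v.ne_zero_iff).2 hx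
  have hint : IsIntegral K₀ x := Algebra.IsIntegral.isIntegral x
  set p := minpoly K₀ x
  have hsum : ∑ i ∈ p.support, algebraMap K₀ K (p.coeff i) * x ^ i = 0 := by
    have := minpoly.aeval K₀ x
    rw [aeval_eq_sum_range, ← Polynomial.sum_over_range' p (f := fun i a => a • x ^ i) (by simp) _
      (Nat.lt_succ_self _), Polynomial.sum_def] at this
    simpa only [Algebra.smul_def] using this
  obtain ⟨i, hi, j, hj, hij, hv⟩ := exists_eq_of_sum_eq_zero v _ _
    (fun i hi => mul_ne_zero ((_root_.map_ne_zero _).2 (mem_support_iff.1 hi)) (pow_ne_zero _ hx))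
    (support_nonempty.2 (minpoly.ne_zero hint)) hsum
  wlog hlt : i < j generalizing i j
  · exact this j hj i hi hij.symm hv.symm (by omega)
  obtain ⟨a, ha⟩ := h _ (mem_support_iff.1 hi)
  obtain ⟨b, hb⟩ := h _ (mem_support_iff.1 hj)
  have hle : j ≤ Module.finrank K₀ K :=
    (le_natDegree_of_mem_supp j hj).trans (minpoly.natDegree_le x)
  obtain ⟨m, hm⟩ := Nat.dvd_factorial (Nat.sub_pos_of_lt hlt) ((Nat.sub_le _ _).trans hle)
  have key : v x ^ (j - i) = (γ : NNReal) ^ (a - b) := by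
    rw [map_mul, map_mul, ha, hb, map_pow, map_pow] at hv
    have hpow : v x ^ j = v x ^ i * v x ^ (j - i) := by rw [← pow_add]; congr 1; omega
    rw [hpow, mul_left_comm, mul_comm] at hv
    have h1 := mul_left_cancel₀ (pow_ne_zero i hvx) hv
    rw [zpow_sub₀ hγ, h1, mul_div_cancel_left₀ _ (zpow_ne_zero _ hγ)]
  exact ⟨(a - b) * m, by rw [hm, pow_mul, key, zpow_mul, zpow_natCast]⟩

theorem natCast_le_one (v : Valuation K NNReal) (n : ℕ) : v n ≤ 1 := by
  induction n with
  | zero => simp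
  | succ n ih =>
    rw [Nat.cast_succ]
    exact (v.map_add _ _).trans (max_le ih (by simp))

theorem exists_natCast_eq_pow (v : Valuation ℚ NNReal) :
    ∃ γ : NNRealˣ, ∀ n : ℕ, n ≠ 0 → ∃ k : ℕ, v n = (γ : NNReal) ^ k := by
  by_cases hne : ∃ p : ℕ, p ≠ 0 ∧ v p < 1
  · classical
    obtain ⟨hp0, hp1⟩ := Nat.find_spec hne
    have hmin : ∀ r < Nat.find hne, r ≠ 0 → v r = 1 := fun r hr hr0 =>
      le_antisymm (natCast_le_one v r) (not_lt.1 fun hlt => Nat.find_min hne hr ⟨hr0, hlt⟩)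
    set p := Nat.find hne
    refine ⟨Units.mk0 (v p) ((v.ne_zero_iff).2 (Nat.cast_ne_zero.2 hp0)), fun n => ?_⟩
    induction n using Nat.strong_induction_on with
    | _ n ih =>
      intro hn
      by_cases hr : n % p = 0
      · obtain ⟨m, rfl⟩ := Nat.dvd_of_mod_eq_zero hr
        have hm : m ≠ 0 := by rintro rfl; simp at hn
        have hp2 : 1 < p := by
          rcases Nat.lt_or_ge 1 p with h | h
          · exact h
          · have : p = 1 := by omega
            simp [this] at hp1
        obtain ⟨k, hk⟩ := ih m (by nlinarith [Nat.pos_of_ne_zero hm]) hm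
        exact ⟨k + 1, by rw [Nat.cast_mul, map_mul, hk, pow_succ']; simp⟩
      · refine ⟨0, ?_⟩
        have h1 := hmin _ (Nat.mod_lt n (Nat.pos_of_ne_zero hp0)) hr
        have h2 : v ((p * (n / p) : ℕ) : ℚ) < 1 := by
          rw [Nat.cast_mul, map_mul]
          exact mul_lt_one_of_lt_of_le hp1 (natCast_le_one v _)
        have h3 : (n : ℚ) = ((n % p : ℕ) : ℚ) + ((p * (n / p) : ℕ) : ℚ) := by
          exact_mod_cast (Nat.mod_add_div n p).symm
        rw [pow_zero, h3, v.map_add_eq_of_lt_left (by rwa [h1]), h1]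
  · push Not at hne
    exact ⟨1, fun n hn => ⟨0, by simpa using le_antisymm (natCast_le_one v n) (hne n hn)⟩⟩

theorem exists_rat_eq_zpow (v : Valuation ℚ NNReal) :
    ∃ γ : NNRealˣ, ∀ x : ℚ, x ≠ 0 → ∃ k : ℤ, v x = (γ : NNReal) ^ k := by
  obtain ⟨γ, h⟩ := exists_natCast_eq_pow v
  refine ⟨γ, fun x hx => ?_⟩
  obtain ⟨a, ha⟩ := h x.num.natAbs (by simpa using hx)
  obtain ⟨b, hb⟩ := h x.den x.den_nz
  refine ⟨a - b, ?_⟩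
  have hnum : v (x.num : ℚ) = v (x.num.natAbs : ℚ) := by
    rcases Int.natAbs_eq x.num with h | h
    · conv_lhs => rw [h]
      simp
    · conv_lhs => rw [h]
      rw [Int.cast_neg, map_neg]; simp
  conv_lhs => rw [← Rat.num_div_den x]
  rw [map_div₀, hnum, ha, hb, zpow_sub₀ γ.ne_zero, zpow_natCast, zpow_natCast]

theorem isTrivialOn_of_finite {F B : Type*} [Field F] [Finite F] [Ring B] [Nontrivial B]
    [Algebra F B] (v : Valuation B NNReal) : IsTrivialOn F v where
  eq_one a ha := by
    have := Fintype.ofFinite F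
    have h1 : a ^ (Fintype.card F - 1) = 1 := FiniteField.pow_card_sub_one_eq_one a ha
    have h2 : v (algebraMap F B a) ^ (Fintype.card F - 1) = 1 := by
      rw [← map_pow, ← map_pow, h1, map_one, map_one]
    exact (pow_eq_one_iff_of_nonneg zero_le
      (Nat.sub_pos_of_lt Fintype.one_lt_card).ne').1 h2

theorem exists_ratFunc_eq_zpow {F : Type*} [Field F] [Finite F] (v : Valuation (RatFunc F) NNReal) :
    ∃ γ : NNRealˣ, ∀ x : RatFunc F, x ≠ 0 → ∃ k : ℤ, v x = (γ : NNReal) ^ k := by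
  have : IsTrivialOn F v := isTrivialOn_of_finite v
  rcases le_or_gt (v RatFunc.X) 1 with hle | hlt
  · by_cases hnt : v.IsNontrivial
    · exact ⟨Units.mk0 (v _) ((v.ne_zero_iff).2
        (by simpa using RatFunc.uniformizingPolynomial_ne_zero hle)),
        fun x hx => RatFunc.exists_zpow_uniformizingPolynomial hle hx⟩
    · refine ⟨1, fun x hx => ⟨0, ?_⟩⟩
      by_contra hne
      exact hnt ⟨x, (v.ne_zero_iff).2 hx, by simpa using hne⟩
  · exact ⟨Units.mk0 (v RatFunc.X) (ne_of_gt (zero_lt_one.trans hlt)), fun x hx => ⟨_,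
      RatFunc.valuation_eq_valuation_X_zpow_intDegree_of_one_lt_valuation_X hlt hx⟩⟩

theorem nontrivial_valueGroup (v : Valuation K NNReal) (hv : v.IsNontrivial) :
    Nontrivial (MonoidWithZeroHom.valueGroup (.ofClass v)) := by
  obtain ⟨x, hx0, hx1⟩ := hv.exists_val_nontrivial
  refine ⟨⟨Units.mk0 (v x) hx0, (MonoidWithZeroHom.mem_valueGroup_iff_of_comm _).2
    ⟨1, by simp, x, by simp⟩⟩, 1, fun h => hx1 ?_⟩
  exact congrArg Units.val (congrArg Subtype.val h)

end Valuation

theorem IsGlobalField.isDiscreteValuationRing {K : Type*} [Field K] (hK : IsGlobalField K)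
    (v : Valuation K NNReal) (hv : v.IsNontrivial) :
    IsDiscreteValuationRing v.valuationSubring := by
  have hnt := v.nontrivial_valueGroup hv
  suffices IsCyclic (MonoidWithZeroHom.valueGroup (.ofClass v)) from inferInstance
  rcases hK with hK | ⟨F, _, _, _, hK⟩
  · obtain ⟨γ, hγ⟩ := (v.comap (algebraMap ℚ K)).exists_rat_eq_zpow
    exact v.isCyclic_valueGroup_of_pow_mem_zpowers γ (Nat.factorial_ne_zero _)
      (v.exists_pow_factorial_eq_zpow γ hγ)
  · obtain ⟨γ, hγ⟩ := (v.comap (algebraMap (RatFunc F) K)).exists_ratFunc_eq_zpow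
    have : FiniteDimensional (RatFunc F) K := hK
    exact v.isCyclic_valueGroup_of_pow_mem_zpowers γ (Nat.factorial_ne_zero _)
      (v.exists_pow_factorial_eq_zpow γ hγ)

open scoped Pointwise in
attribute [local instance] Ideal.Quotient.field in
/-- The order of the decomposition group is at most the order of the inertia group times the
inertia degree. -/
theorem Ideal.card_stabilizer_le_card_inertia_mul_inertiaDeg {R S G : Type*} [CommRing R]
    [CommRing S] [Algebra R S] [Group G] [MulSemiringAction G S] [IsGaloisGroup G R S] [Finite G]
    [Module.Finite R S]
    (p : Ideal R) [p.IsPrime] (P : Ideal S) [P.LiesOver p] [P.IsPrime] :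
    Nat.card (MulAction.stabilizer G P) ≤ Nat.card (inertia G P) * P.inertiaDeg R := by
  let := Localization.AtPrime.algebraOfLiesOver p P
  have heq : (algebraMap (S ⧸ P) P.ResidueField).comp (algebraMap (R ⧸ p) (S ⧸ P)) =
      (algebraMap p.ResidueField P.ResidueField).comp (algebraMap (R ⧸ p) p.ResidueField) := by
    ext
    simp [← IsScalarTower.algebraMap_apply]
  let := ((algebraMap (S ⧸ P) P.ResidueField).comp (algebraMap (R ⧸ p) (S ⧸ P))).toAlgebra
  have : IsScalarTower (R ⧸ p) (S ⧸ P) P.ResidueField := .of_algebraMap_eq' rfl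
  have : IsScalarTower (R ⧸ p) p.ResidueField P.ResidueField := .of_algebraMap_eq' heq
  have : FiniteDimensional p.ResidueField P.ResidueField := by
    exact Module.Finite.of_equiv_equiv (RingEquiv.refl _) (RingEquiv.refl _) rfl
  have hidx : Subgroup.index _ = _ := Nat.card_congr
    (IsFractionRing.stabilizerQuotientInertiaEquiv G p P p.ResidueField P.ResidueField).toEquiv
  have hle : Nat.card Gal(P.ResidueField/p.ResidueField) ≤ P.inertiaDeg R := by
    rw [inertiaDeg_eq p P, Nat.card_eq_fintype_card]
    exact AlgEquiv.card_le
  rw [← ((inertia G P).subgroupOf (MulAction.stabilizer G P)).card_mul_index,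
    Nat.card_congr (Subgroup.subgroupOfEquivOfLe (inertia_le_stabilizer (M := G) P)).toEquiv,
    AddSubgroup.subgroupOf_inertia, hidx]
  exact Nat.mul_le_mul_left _ hle

open scoped Pointwise in
/-- The ramification index is at most the order of the inertia group. -/
theorem Ideal.ramificationIdx_le_card_inertia {R S G : Type*} [CommRing R]
    [CommRing S] [Algebra R S] [Group G] [MulSemiringAction G S] [IsGaloisGroup G R S] [Finite G]
    [IsDomain R] [IsDomain S] [Module.Finite R S] [Module.Flat R S] [FaithfulSMul R S]
    (p : Ideal R) [p.IsPrime] (P : Ideal S) [P.LiesOver p] [P.IsPrime] :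
    P.ramificationIdx R ≤ Nat.card (inertia G P) := by
  have hstab := card_stabilizer_le_card_inertia_mul_inertiaDeg (G := G) p P
  have hsum := ncard_primesOver_mul_ramificationIdxIn_mul_inertiaDegIn p S G
  have horb : (p.primesOver S).ncard * Nat.card (MulAction.stabilizer G P) = Nat.card G := by
    rw [← Algebra.IsInvariant.orbit_eq_primesOver R S G p P]
    simpa using! Nat.card_congr (MulAction.orbitProdStabilizerEquivGroup G P)
  rw [ramificationIdxIn_eq_ramificationIdx p P G, inertiaDegIn_eq_inertiaDeg p P G, ← horb] at hsum
  have hG : 0 < Nat.card G := Nat.card_pos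
  have h1 : 0 < (p.primesOver S).ncard := Nat.pos_of_mul_pos_right (horb ▸ hG)
  have h2 := Nat.eq_of_mul_eq_mul_left h1 hsum
  rw [← h2] at hstab
  exact Nat.le_of_mul_le_mul_right hstab (P.inertiaDeg_pos R)

/-- The map `x ↦ x ^ d + c`. -/
def unicrit {R : Type*} [Semiring R] (d : ℕ) (c : R) (x : R) : R := x ^ d + c

theorem map_iterate_unicrit {R S F : Type*} [Semiring R] [Semiring S] [FunLike F R S]
    [RingHomClass F R S] (φ : F) (d : ℕ) (c : R) (n : ℕ) (x : R) :
    φ ((unicrit d c)^[n] x) = (unicrit d (φ c))^[n] (φ x) :=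
  (Function.Semiconj.iterate_right (f := φ) (ga := unicrit d c) (gb := unicrit d (φ c))
    (fun x => by simp [unicrit]) n) x

theorem isIntegral_of_iterate_unicrit {A L : Type*} [CommRing A] [CommRing L] [Algebra A L]
    {d : ℕ} (hd : d ≠ 0) (c : A) {n : ℕ} {x : L}
    (hx : IsIntegral A ((unicrit d (algebraMap A L c))^[n] x)) : IsIntegral A x := by
  induction n generalizing x with
  | zero => exact hx
  | succ n ih =>
    have h := ih (x := unicrit d (algebraMap A L c) x) (by rwa [← Function.iterate_succ_apply])
    refine IsIntegral.of_pow (Nat.pos_of_ne_zero hd) ?_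
    simpa [unicrit] using h.sub (isIntegral_algebraMap (x := c))

theorem Ideal.map_maximalIdeal_le_jacobson_bot {A B : Type*} [CommRing A] [IsLocalRing A]
    [CommRing B] [Algebra A B] [Algebra.IsIntegral A B] :
    (IsLocalRing.maximalIdeal A).map (algebraMap A B) ≤ (⊥ : Ideal B).jacobson := by
  rw [Ideal.map_le_iff_le_comap]
  intro a ha
  rw [Ideal.mem_comap, Ideal.jacobson, Ideal.mem_sInf]
  rintro M ⟨-, hM⟩
  have := Ideal.isMaximal_comap_of_isIntegral_of_isMaximal (R := A) M
  rw [← IsLocalRing.eq_maximalIdeal this] at ha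
  exact ha

/-- A root of an iterate of `x ↦ x ^ d + c`, with `c` in the Jacobson radical, has a power
associated to `c`. -/
theorem associated_pow_of_iterate_unicrit_eq_zero {B : Type*} [CommRing B] {d : ℕ} (hd : 2 ≤ d)
    {c : B} (hc : c ∈ (⊥ : Ideal B).jacobson) (n : ℕ) {x : B}
    (hx : (unicrit d c)^[n + 1] x = 0) : Associated (x ^ d ^ (n + 1)) c := by
  induction n generalizing x with
  | zero =>
    have h : x ^ d = -c := eq_neg_of_add_eq_zero_left (by simpa [unicrit] using hx)
    rw [zero_add, pow_one, h]
    exact Associated.neg_left (Associated.refl c)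
  | succ n ih =>
    rw [Function.iterate_succ_apply] at hx
    have hz := ih hx
    set z := unicrit d c x with hzdef
    obtain ⟨u, hu⟩ := hz
    have hN : 2 ≤ d ^ (n + 1) := hd.trans (Nat.le_self_pow (by omega) d)
    have hzJ : z ∈ (⊥ : Ideal B).jacobson := by
      refine (Ideal.isRadical_jacobson _) ⟨d ^ (n + 1), ?_⟩
      have : z ^ d ^ (n + 1) = c * ((u⁻¹ : Bˣ) : B) := by rw [← hu, Units.mul_inv_cancel_right]
      rw [this]
      exact Ideal.mul_mem_right _ _ hc
    have hunit := (Ideal.mem_jacobson_bot.1 hzJ) (-(z ^ (d ^ (n + 1) - 2) * u))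
    have hxd : Associated z (x ^ d) := by
      refine ⟨hunit.unit, ?_⟩
      have h1 : x ^ d = z - c := by simp [hzdef, unicrit]
      have h2 : z ^ d ^ (n + 1) = z * z * z ^ (d ^ (n + 1) - 2) := by
        rw [← sq, ← pow_add]; congr 1; omega
      rw [IsUnit.unit_spec, h1, ← hu, h2]
      ring
    rw [pow_succ' d, pow_mul]
    exact (hxd.symm.pow_pow).trans ⟨u, hu⟩

/-- Roots of unity of order prime to the residue characteristic are distinct modulo `P`. -/
theorem eq_of_pow_eq_one_of_sub_mem {B : Type*} [CommRing B] [IsDomain B] {P : Ideal B}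
    [hP : P.IsPrime] {d : ℕ} (hdP : (d : B) ∉ P) {a b : B} (ha : a ^ d = 1) (hb : b ^ d = 1)
    (hab : a - b ∈ P) : a = b := by
  have hd : d ≠ 0 := by rintro rfl; simp at hdP
  by_contra hne
  have hsum : ∑ i ∈ Finset.range d, a ^ i * b ^ (d - 1 - i) = 0 := by
    have := (Commute.all a b).geom_sum₂_mul d
    rw [ha, hb, sub_self] at this
    exact (mul_eq_zero.1 this).resolve_right (sub_ne_zero.2 hne)
  have hmod : Ideal.Quotient.mk P a = Ideal.Quotient.mk P b := Ideal.Quotient.eq.2 hab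
  have h0 : Ideal.Quotient.mk P ((d : B) * b ^ (d - 1)) = 0 := by
    rw [← map_zero (Ideal.Quotient.mk P), ← hsum, map_sum]
    have : ∀ i ∈ Finset.range d, Ideal.Quotient.mk P (a ^ i * b ^ (d - 1 - i)) =
        Ideal.Quotient.mk P (b ^ (d - 1)) := fun i hi => by
      rw [map_mul, map_pow, hmod, ← map_pow, ← map_mul, ← pow_add]
      congr 2
      have := Finset.mem_range.1 hi
      omega
    rw [Finset.sum_congr rfl this, Finset.sum_const, Finset.card_range, nsmul_eq_mul, map_mul,
      map_natCast]
  rcases hP.mem_or_mem (Ideal.Quotient.eq_zero_iff_mem.1 h0) with h | h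
  · exact hdP h
  · refine hP.ne_top ((Ideal.eq_top_iff_one P).2 ?_)
    rw [← hb, ← Nat.sub_add_cancel (Nat.pos_of_ne_zero hd), pow_succ]
    exact Ideal.mul_mem_right _ _ h

theorem IsPrimitiveRoot.exists_eq_pow_mul_of_pow_eq_pow {B : Type*} [CommRing B] [IsDomain B]
    {d : ℕ} [NeZero d] {ζ : B} (hζ : IsPrimitiveRoot ζ d) {x y : B} (hy : y ≠ 0)
    (h : x ^ d = y ^ d) : ∃ j, x = ζ ^ j * y := by
  have hinj := IsFractionRing.injective B (FractionRing B)
  have hy' : algebraMap B (FractionRing B) y ≠ 0 := (map_ne_zero_iff _ hinj).2 hy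
  obtain ⟨j, -, hj⟩ := (hζ.map_of_injective hinj).eq_pow_of_pow_eq_one
    (ξ := algebraMap B (FractionRing B) x / algebraMap B (FractionRing B) y)
    (by rw [div_pow, ← map_pow, ← map_pow, h, div_self]; rw [map_pow]; exact pow_ne_zero _ hy')
  refine ⟨j, hinj ?_⟩
  rw [map_mul, map_pow, hj, div_mul_cancel₀ _ hy']

/-- If `x ^ N` is associated to an element of value `ν` in the base discrete valuation ring, then
`N ≤ ν e`. -/
theorem Ideal.le_mul_ramificationIdx_of_associated {A B : Type*} [CommRing A] [IsDomain A]
    [IsDiscreteValuationRing A] [CommRing B] [IsDedekindDomain B] [Algebra A B] [FaithfulSMul A B]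
    (P : Ideal B) [P.IsPrime] [P.LiesOver (IsLocalRing.maximalIdeal A)] {ϖ c : A} {ν N : ℕ}
    (hϖ : Irreducible ϖ) (hν : ν ≠ 0) (hc : Associated c (ϖ ^ ν)) {x : B}
    (hx : Associated (x ^ N) (algebraMap A B c)) : N ≤ ν * P.ramificationIdx A := by
  set p := IsLocalRing.maximalIdeal A
  have hp0 : p.map (algebraMap A B) ≠ ⊥ :=
    Ideal.map_ne_bot_of_ne_bot (IsDiscreteValuationRing.not_a_field A)
  have hmap : p.map (algebraMap A B) = Ideal.span {algebraMap A B ϖ} := by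
    rw [show p = Ideal.span {ϖ} from hϖ.maximalIdeal_eq, Ideal.map_span, Set.image_singleton]
  have hPle : p.map (algebraMap A B) ≤ P := Ideal.map_le_of_le_comap (P.over_def p).le
  have hP0 : P ≠ ⊥ := fun h => hp0 (le_bot_iff.1 (h ▸ hPle))
  have hP : Prime P := Ideal.prime_of_isPrime hP0 ‹_›
  have hspan : Ideal.span {x} ^ N = p.map (algebraMap A B) ^ ν := by
    rw [hmap, Ideal.span_singleton_pow, Ideal.span_singleton_pow, ← map_pow,
      Ideal.span_singleton_eq_span_singleton]
    exact hx.trans (hc.map (algebraMap A B))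
  rcases Nat.eq_zero_or_pos N with rfl | hN
  · exact Nat.zero_le _
  have hxP : P ∣ Ideal.span {x} := by
    refine hP.dvd_of_dvd_pow (n := N) ?_
    rw [hspan]
    exact dvd_pow (Ideal.dvd_iff_le.2 hPle) hν
  have hfin : FiniteMultiplicity P (p.map (algebraMap A B)) :=
    FiniteMultiplicity.of_prime_left hP hp0
  have hmul : (N : ℕ∞) * emultiplicity P (Ideal.span {x}) =
      ν * emultiplicity P (p.map (algebraMap A B)) := by
    rw [← emultiplicity_pow hP, hspan, emultiplicity_pow hP]
  rw [hfin.emultiplicity_eq_multiplicity,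
    ← Ideal.IsDedekindDomain.ramificationIdx_eq_multiplicity p P hp0] at hmul
  have h1 : (1 : ℕ∞) ≤ emultiplicity P (Ideal.span {x}) :=
    le_emultiplicity_of_pow_dvd (k := 1) (by simpa using hxP)
  have h2 : (N : ℕ∞) * 1 ≤ ν * P.ramificationIdx A := hmul ▸ mul_le_mul_right h1 _
  rw [mul_one] at h2
  exact_mod_cast h2

section Counting

variable {B G : Type*} [CommRing B] [Group G] [MulSemiringAction G B]

/-- The elements of the inertia group of `P` that fix all roots of the iterates of `x ↦ x ^ d + c`
up to the `i`th. -/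
def inertiaFixing (G : Type*) [Group G] [MulSemiringAction G B] (P : Ideal B) (d : ℕ) (c : B)
    (i : ℕ) : Subgroup G :=
  P.inertia G ⊓ fixingSubgroup G {x | ∃ j ≤ i, (unicrit d c)^[j] x = 0}

theorem mem_inertiaFixing {P : Ideal B} {d : ℕ} {c : B} {i : ℕ} {σ : G} :
    σ ∈ inertiaFixing G P d c i ↔
      (∀ x, σ • x - x ∈ P) ∧ ∀ j ≤ i, ∀ x, (unicrit d c)^[j] x = 0 → σ • x = x := by
  simp only [inertiaFixing, Subgroup.mem_inf, AddSubgroup.mem_inertia, mem_fixingSubgroup_iff,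
    Set.mem_ofPred_eq]
  refine and_congr Iff.rfl ⟨fun h j hj x hx => h x ⟨j, hj, hx⟩, fun h x ⟨j, hj, hx⟩ => h j hj x hx⟩

theorem inertiaFixing_antitone (P : Ideal B) (d : ℕ) (c : B) {i j : ℕ} (hij : i ≤ j) :
    inertiaFixing G P d c j ≤ inertiaFixing G P d c i := fun _ hσ =>
  mem_inertiaFixing.2 ⟨(mem_inertiaFixing.1 hσ).1,
    fun k hk => (mem_inertiaFixing.1 hσ).2 k (hk.trans hij)⟩

theorem smul_eq_mul_of_smul_eq_mul [IsDedekindDomain B] {P : Ideal B} [P.IsPrime] {d : ℕ} (hd : 2 ≤ d)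
    (hdP : (d : B) ∉ P) {c : B} (hc : c ∈ (⊥ : Ideal B).jacobson) (hc0 : c ≠ 0) {i : ℕ} {σ : G}
    (hσ : ∀ x, σ • x - x ∈ P) {x y a b : B} (hx : (unicrit d c)^[i + 1] x = 0)
    (hy : (unicrit d c)^[i + 1] y = 0) (ha : a ^ d = 1) (hb : b ^ d = 1) (hxa : σ • x = a * x)
    (hyb : σ • y = b * y) : a = b := by
  have hN : d ^ (i + 1) ≠ 0 := pow_ne_zero _ (by omega)
  have hx' := associated_pow_of_iterate_unicrit_eq_zero hd hc i hx
  have hy' := associated_pow_of_iterate_unicrit_eq_zero hd hc i hy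
  obtain ⟨u, rfl⟩ := (Associated.pow_iff hN).1 (hx'.trans hy'.symm)
  have hx0 : x ≠ 0 := by
    rintro rfl
    rw [zero_pow hN] at hx'
    exact hc0 (hx'.eq_zero_iff.1 rfl)
  have h1 : a * σ • (u : B) = b * u := by
    refine mul_left_cancel₀ hx0 ?_
    rw [smul_mul', hxa] at hyb
    linear_combination hyb
  refine (eq_of_pow_eq_one_of_sub_mem hdP hb ha ?_).symm
  have h2 : (b - a) * u ∈ P := by
    have : (b - a) * u = a * (σ • (u : B) - u) := by linear_combination -h1
    rw [this]
    exact Ideal.mul_mem_left _ _ (hσ _)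
  exact (Ideal.IsPrime.mem_or_mem ‹_› h2).resolve_right
    fun h => ‹P.IsPrime›.ne_top (Ideal.eq_top_of_isUnit_mem _ h u.isUnit)

variable {A : Type*} [CommRing A] [IsDomain A] [IsDedekindDomain B] [Algebra A B]
  [FaithfulSMul A B]

/-- The index of consecutive groups `inertiaFixing` divides `d`; if it is `d`, some element
multiplies all roots of the next iterate by `ζ`. -/
theorem exists_card_inertiaFixing_eq_mul [SMulCommClass G A B] [Finite G]
    {P : Ideal B} [P.IsPrime] {d : ℕ} (hd : 2 ≤ d)
    (hdP : (d : B) ∉ P) {ζ : A} (hζ : IsPrimitiveRoot ζ d) {c : A}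
    (hc : algebraMap A B c ∈ (⊥ : Ideal B).jacobson) (hc0 : c ≠ 0) {i : ℕ} {x₀ : B}
    (hx₀ : (unicrit d (algebraMap A B c))^[i + 1] x₀ = 0) :
    ∃ r, r ∣ d ∧ Nat.card (inertiaFixing G P d (algebraMap A B c) i) =
        r * Nat.card (inertiaFixing G P d (algebraMap A B c) (i + 1)) ∧
      (r = d → ∃ σ : G, (∀ j ≤ i, ∀ x, (unicrit d (algebraMap A B c))^[j] x = 0 → σ • x = x) ∧
        ∀ x, (unicrit d (algebraMap A B c))^[i + 1] x = 0 → σ • x = algebraMap A B ζ * x) := by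
  have : NeZero d := ⟨by omega⟩
  have hinj := FaithfulSMul.algebraMap_injective A B
  have hζB := hζ.map_of_injective hinj
  set c' := algebraMap A B c
  have hc0' : c' ≠ 0 := (map_ne_zero_iff _ hinj).2 hc0
  set S := inertiaFixing G P d c' i
  have hne : ∀ x, (unicrit d c')^[i + 1] x = 0 → x ≠ 0 := by
    rintro x hx rfl
    have h := associated_pow_of_iterate_unicrit_eq_zero hd hc i hx
    rw [zero_pow (pow_ne_zero _ (by omega))] at h
    exact hc0' (h.eq_zero_iff.1 rfl)
  have hex : ∀ σ ∈ S, ∀ x, (unicrit d c')^[i + 1] x = 0 →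
      ∃ η : rootsOfUnity d A, σ • x = algebraMap A B (η : Aˣ) * x := by
    intro σ hσ x hx
    have hfix := (mem_inertiaFixing.1 hσ).2 i le_rfl (unicrit d c' x)
      (by rwa [← Function.iterate_succ_apply])
    have hpow : (σ • x) ^ d = x ^ d := by
      rw [unicrit, smul_add, smul_algebraMap, smul_pow'] at hfix
      exact add_right_cancel hfix
    obtain ⟨j, hj⟩ := hζB.exists_eq_pow_mul_of_pow_eq_pow (hne x hx) hpow
    refine ⟨hζ.toRootsOfUnity ^ j, ?_⟩
    simpa using hj
  have hex' : ∀ σ : S, ∃ η : rootsOfUnity d A, (σ : G) • x₀ = algebraMap A B (η : Aˣ) * x₀ :=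
    fun σ => hex σ σ.2 x₀ hx₀
  choose θ hθ using hex'
  have hθ' : ∀ (σ : S) x, (unicrit d c')^[i + 1] x = 0 →
      (σ : G) • x = algebraMap A B (θ σ : Aˣ) * x := by
    intro σ x hx
    obtain ⟨η, hη⟩ := hex σ σ.2 x hx
    have hpow : ∀ ξ : rootsOfUnity d A, (algebraMap A B (ξ : Aˣ)) ^ d = 1 := fun ξ => by
      rw [← map_pow, (mem_rootsOfUnity' _ _).1 ξ.2, map_one]
    rw [hη, smul_eq_mul_of_smul_eq_mul hd hdP hc hc0' (mem_inertiaFixing.1 σ.2).1 hx hx₀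
      (hpow η) (hpow (θ σ)) hη (hθ σ)]
  have hmul : ∀ σ τ, θ (σ * τ) = θ σ * θ τ := by
    intro σ τ
    refine Subtype.ext (Units.ext (hinj (mul_right_cancel₀ (hne x₀ hx₀) ?_)))
    rw [← hθ, Subgroup.coe_mul, mul_smul, hθ τ, smul_mul', smul_algebraMap, hθ σ, Subgroup.coe_mul,
      Units.val_mul, map_mul]
    ring
  let φ : S →* rootsOfUnity d A := MonoidHom.mk' θ hmul
  have hcard : Nat.card (rootsOfUnity d A) = d := hζ.card_rootsOfUnity
  have hker : φ.ker = (inertiaFixing G P d c' (i + 1)).subgroupOf S := by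
    ext σ
    rw [MonoidHom.mem_ker, Subgroup.mem_subgroupOf, mem_inertiaFixing]
    constructor
    · intro h1
      refine ⟨(mem_inertiaFixing.1 σ.2).1, fun j hj x hx => ?_⟩
      rcases Nat.lt_or_ge i j with hij | hij
      · obtain rfl : j = i + 1 := by omega
        have h2 : θ σ = 1 := h1
        rw [hθ' σ x hx, h2]
        simp
      · exact (mem_inertiaFixing.1 σ.2).2 j hij x hx
    · rintro ⟨-, h⟩
      refine Subtype.ext (Units.ext (hinj (mul_right_cancel₀ (hne x₀ hx₀) ?_)))
      have h1 : (algebraMap A B) (θ σ : Aˣ) * x₀ = x₀ := by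
        rw [← hθ, h _ le_rfl x₀ hx₀]
      simpa [φ] using h1
  refine ⟨Nat.card φ.range, (Subgroup.card_subgroup_dvd_card _).trans (dvd_of_eq hcard), ?_, fun hr => ?_⟩
  · rw [← φ.ker.card_mul_index, Subgroup.index_ker, hker, mul_comm,
      Nat.card_congr (Subgroup.subgroupOfEquivOfLe
        (inertiaFixing_antitone (G := G) P d c' (Nat.le_succ i))).toEquiv]
  · have htop : φ.range = ⊤ := Subgroup.eq_top_of_card_eq _ (hr.trans hcard.symm)
    obtain ⟨σ, hσ⟩ := (MonoidHom.range_eq_top.1 htop) hζ.toRootsOfUnity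
    refine ⟨σ, (mem_inertiaFixing.1 σ.2).2, fun x hx => ?_⟩
    have h2 : θ σ = hζ.toRootsOfUnity := hσ
    rw [hθ' σ x hx, h2]
    simp

/-- If the Galois group acts faithfully on the roots of the `n`th iterate of `x ↦ x ^ d + c`, then
at most `log₂ ν` of the levels below `n` have no Galois element that fixes that level and multiplies
the next by `ζ`. -/
theorem two_pow_card_le_of_unicrit [IsDiscreteValuationRing A] [Module.Finite A B] [Finite G]
    [IsGaloisGroup G A B] {d : ℕ} (hd : 2 ≤ d) (hdA : IsUnit (d : A)) {ζ : A}
    (hζ : IsPrimitiveRoot ζ d) {ϖ c : A} {ν : ℕ} (hϖ : Irreducible ϖ) (hν : ν ≠ 0)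
    (hc : Associated c (ϖ ^ ν)) {n : ℕ} {x₀ : B}
    (hx₀ : (unicrit d (algebraMap A B c))^[n] x₀ = 0)
    (hfaith : ∀ σ : G, (∀ x, (unicrit d (algebraMap A B c))^[n] x = 0 → σ • x = x) → σ = 1)
    (t : Finset ℕ) (ht : ∀ i ∈ t, i < n ∧ ¬ ∃ σ : G,
      (∀ j ≤ i, ∀ x, (unicrit d (algebraMap A B c))^[j] x = 0 → σ • x = x) ∧
      ∀ x, (unicrit d (algebraMap A B c))^[i + 1] x = 0 → σ • x = algebraMap A B ζ * x) :
    2 ^ t.card ≤ ν := by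
  classical
  obtain ⟨⟨P, hP, hPover⟩⟩ :=
    (inferInstance : Nonempty ((IsLocalRing.maximalIdeal A).primesOver B))
  set c' := algebraMap A B c with hc'
  set bad : ℕ → Prop := fun i => ¬ ∃ σ : G,
      (∀ j ≤ i, ∀ x, (unicrit d c')^[j] x = 0 → σ • x = x) ∧
      ∀ x, (unicrit d c')^[i + 1] x = 0 → σ • x = algebraMap A B ζ * x with hbad
  have hc0 : c ≠ 0 := fun h => pow_ne_zero ν hϖ.ne_zero (hc.eq_zero_iff.1 h)
  have hcm : c ∈ IsLocalRing.maximalIdeal A := by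
    rw [hϖ.maximalIdeal_eq, Ideal.mem_span_singleton]
    exact (dvd_pow_self ϖ hν).trans hc.symm.dvd
  have hcJ : c' ∈ (⊥ : Ideal B).jacobson :=
    Ideal.map_maximalIdeal_le_jacobson_bot (Ideal.mem_map_of_mem _ hcm)
  have hdP : (d : B) ∉ P := fun h => hP.ne_top
    (Ideal.eq_top_of_isUnit_mem _ h (by simpa using hdA.map (algebraMap A B)))
  have hstep : ∀ m ≤ n, Nat.card (inertiaFixing G P d c' 0) *
      2 ^ ((Finset.range m).filter bad).card ≤ d ^ m * Nat.card (inertiaFixing G P d c' m) := by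
    intro m
    induction m with
    | zero => simp
    | succ m ih =>
      intro hm
      obtain ⟨r, hrd, hr, hσ⟩ := exists_card_inertiaFixing_eq_mul (G := G) (P := P) hd hdP hζ hcJ hc0
        (i := m) (x₀ := (unicrit d c')^[n - (m + 1)] x₀)
        (by rw [← Function.iterate_add_apply, Nat.add_sub_cancel' hm, hx₀])
      have ih := ih (by omega)
      rw [hr] at ih
      rw [Finset.range_add_one, Finset.filter_insert]
      have hdpos : 0 < d := by omega
      split_ifs with hb
      · rw [Finset.card_insert_of_notMem (by simp), pow_succ]
        have hr2 : 2 * r ≤ d := by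
          obtain ⟨k, hk⟩ := hrd
          have hk1 : k ≠ 1 := fun h => hb (hσ (by rw [hk, h, mul_one]))
          have hk0 : k ≠ 0 := by rintro rfl; omega
          have : 2 ≤ k := by omega
          rw [hk, mul_comm]
          exact Nat.mul_le_mul_left r this
        calc _ = Nat.card (inertiaFixing G P d c' 0) * 2 ^ ((Finset.range m).filter bad).card * 2 :=
              by ring
          _ ≤ d ^ m * (r * Nat.card (inertiaFixing G P d c' (m + 1))) * 2 :=
              Nat.mul_le_mul_right _ ih
          _ = d ^ m * Nat.card (inertiaFixing G P d c' (m + 1)) * (2 * r) := by ring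
          _ ≤ d ^ m * Nat.card (inertiaFixing G P d c' (m + 1)) * d := Nat.mul_le_mul_left _ hr2
          _ = _ := by ring
      · calc _ ≤ d ^ m * (r * Nat.card (inertiaFixing G P d c' (m + 1))) := ih
          _ = d ^ m * Nat.card (inertiaFixing G P d c' (m + 1)) * r := by ring
          _ ≤ d ^ m * Nat.card (inertiaFixing G P d c' (m + 1)) * d :=
              Nat.mul_le_mul_left _ (Nat.le_of_dvd hdpos hrd)
          _ = _ := by ring
  have hlast : Nat.card (inertiaFixing G P d c' n) = 1 := by
    rw [(Subgroup.eq_bot_iff_forall _).2 fun σ hσ =>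
      hfaith σ ((mem_inertiaFixing.1 hσ).2 n le_rfl)]
    exact Subgroup.card_bot
  have hfirst : inertiaFixing G P d c' 0 = P.inertia G := by
    refine le_antisymm inf_le_left fun σ hσ => mem_inertiaFixing.2 ⟨hσ, fun j hj x hx => ?_⟩
    obtain rfl : j = 0 := by omega
    obtain rfl : x = 0 := hx
    exact smul_zero σ
  have htcard : t.card ≤ ((Finset.range n).filter bad).card :=
    Finset.card_le_card fun i hi =>
      Finset.mem_filter.2 ⟨Finset.mem_range.2 (ht i hi).1, (ht i hi).2⟩
  refine (Nat.pow_le_pow_right two_pos htcard).trans ?_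
  rcases Nat.eq_zero_or_pos n with rfl | hn
  · simpa using Nat.one_le_iff_ne_zero.2 hν
  have hpow : d ^ n ≤ ν * P.ramificationIdx A := by
    obtain ⟨k, rfl⟩ := Nat.exists_eq_succ_of_ne_zero hn.ne'
    exact P.le_mul_ramificationIdx_of_associated hϖ hν hc
      (associated_pow_of_iterate_unicrit_eq_zero hd hcJ k hx₀)
  have he := Ideal.ramificationIdx_le_card_inertia (G := G) (IsLocalRing.maximalIdeal A) P
  have hfin := hstep n le_rfl
  rw [hlast, mul_one, hfirst] at hfin
  have hI : 0 < Nat.card (P.inertia G) := Nat.card_pos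
  refine Nat.le_of_mul_le_mul_left (hfin.trans (hpow.trans ?_)) hI
  rw [mul_comm]
  exact Nat.mul_le_mul_right _ he

end Counting

namespace GaloisProcess

variable {K : Type*} [Field K]

theorem iter_succ (f : K[X]) (n : ℕ) : iter f (n + 1) = f.comp (iter f n) :=
  Function.iterate_succ_apply' _ _ _

theorem aeval_iter {L : Type*} [Field L] [Algebra K L] (d : ℕ) (c : K) (n : ℕ) (x : L) :
    aeval x (iter (X ^ d + C c) n) = (unicrit d (algebraMap K L c))^[n] x := by
  induction n with
  | zero => simp [iter]
  | succ n ih =>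
    rw [iter_succ, aeval_comp, ih, Function.iterate_succ_apply']
    simp [unicrit]

theorem aeval_derivative_iter_ne_zero {L : Type*} [Field L] [Algebra K L] {d : ℕ}
    (hd : (d : K) ≠ 0) (c : K) (n : ℕ) (x : L)
    (hx : ∀ j < n, (unicrit d (algebraMap K L c))^[j] x ≠ 0) :
    aeval x (derivative (iter (X ^ d + C c) n)) ≠ 0 := by
  induction n with
  | zero => simp [iter]
  | succ n ih =>
    have h1 := ih fun j hj => hx j (hj.trans (Nat.lt_succ_self n))
    have hd' : (d : L) ≠ 0 := by
      simpa using (map_ne_zero_iff _ (algebraMap K L).injective).2 hd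
    rw [iter_succ, derivative_comp, map_mul, aeval_comp, aeval_iter]
    refine mul_ne_zero h1 ?_
    simpa [derivative_X_pow, hd'] using fun h => absurd h (hx n (Nat.lt_succ_self n))

theorem separable_iter {d : ℕ} (hd : (d : K) ≠ 0) (c : K)
    (h0 : ∀ n, (unicrit d c)^[n + 1] 0 ≠ 0) (n : ℕ) : (iter (X ^ d + C c) n).Separable := by
  rw [Polynomial.Separable, isCoprime_iff_aeval_ne_zero_of_isAlgClosed K (AlgebraicClosure K)]
  intro x
  rw [or_iff_not_imp_left, not_not, aeval_iter]
  intro hx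
  refine aeval_derivative_iter_ne_zero hd c n x fun j hj hj0 => ?_
  obtain ⟨k, rfl⟩ := Nat.exists_eq_add_of_lt hj
  rw [show j + k + 1 = (k + 1) + j by ring, Function.iterate_add_apply, hj0,
    ← map_zero (algebraMap K (AlgebraicClosure K)), ← map_iterate_unicrit] at hx
  exact h0 k ((algebraMap K (AlgebraicClosure K)).injective hx)

end GaloisProcess

theorem exists_iterate_unicrit_eq {L : Type*} [Field L] [IsAlgClosed L] {d : ℕ} (hd : d ≠ 0) (c : L)
    (n : ℕ) (y : L) : ∃ x, (unicrit d c)^[n] x = y := by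
  have hsurj : Function.Surjective (unicrit d c) := fun z => by
    obtain ⟨w, hw⟩ := IsAlgClosed.exists_pow_nat_eq (z - c) (Nat.pos_of_ne_zero hd)
    exact ⟨w, by simp [unicrit, hw]⟩
  exact hsurj.iterate n y

theorem iterate_unicrit_mem {K L : Type*} [Field K] [Field L] [Algebra K L]
    (E : IntermediateField K L) {d : ℕ} {c : K} {n : ℕ} {x : L}
    (hx : x ∈ E) : (unicrit d (algebraMap K L c))^[n] x ∈ E := by
  have := map_iterate_unicrit (algebraMap E L) d (algebraMap K E c) n ⟨x, hx⟩
  rw [← IsScalarTower.algebraMap_apply] at this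
  change _ = (unicrit d (algebraMap K L c))^[n] x at this
  rw [← this]
  exact SetLike.coe_mem _

theorem iterate_unicrit_zero_ne_zero {A : Type*} [CommRing A] [IsDomain A] [IsLocalRing A] {d : ℕ}
    (hd : 2 ≤ d) {c : A} (hc : c ∈ IsLocalRing.maximalIdeal A) (hc0 : c ≠ 0) (n : ℕ) :
    (unicrit d c)^[n + 1] 0 ≠ 0 := by
  intro hn
  have h := associated_pow_of_iterate_unicrit_eq_zero hd
    (IsLocalRing.maximalIdeal_le_jacobson ⊥ hc) n hn
  rw [zero_pow (pow_ne_zero _ (by omega))] at h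
  exact hc0 (h.eq_zero_iff.1 rfl)

open GaloisProcess in
/-- For all large `n`, some automorphism of the algebraic closure of `K` fixes the roots of the
iterates of `x ↦ x ^ d + c` up to the `n`th and multiplies the roots of the next one by `ζ`. -/
theorem exists_forall_exists_gal_unicrit {A K : Type*} [CommRing A] [IsDomain A]
    [IsDiscreteValuationRing A] [Field K] [Algebra A K] [IsFractionRing A K] {d : ℕ} (hd : 2 ≤ d)
    (hdA : IsUnit (d : A)) {ζ : K} (hζ : IsPrimitiveRoot ζ d) {c : A}
    (hc : c ∈ IsLocalRing.maximalIdeal A) (hc0 : c ≠ 0) :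
    ∃ N, ∀ i ≥ N, ∃ σ : Gal(AlgebraicClosure K/K),
      (∀ j ≤ i, ∀ x, (unicrit d (algebraMap K (AlgebraicClosure K) (algebraMap A K c)))^[j] x = 0 →
        σ x = x) ∧
      ∀ x, (unicrit d (algebraMap K (AlgebraicClosure K) (algebraMap A K c)))^[i + 1] x = 0 →
        σ x = algebraMap K (AlgebraicClosure K) ζ * x := by
  classical
  have hd0 : d ≠ 0 := by omega
  have hinjAK := IsFractionRing.injective A K
  obtain ⟨ϖ, hϖ⟩ := IsDiscreteValuationRing.exists_irreducible A
  obtain ⟨ν, hν⟩ := IsDiscreteValuationRing.associated_pow_irreducible hc0 hϖ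
  have hν0 : ν ≠ 0 := by
    rintro rfl
    rw [pow_zero] at hν
    exact (IsLocalRing.mem_maximalIdeal _).1 hc (hν.symm.isUnit isUnit_one)
  obtain ⟨z, rfl⟩ : ∃ z, algebraMap A K z = ζ :=
    IsIntegrallyClosed.isIntegral_iff.1 (hζ.isIntegral (Nat.pos_of_ne_zero hd0)).tower_top
  have hz : IsPrimitiveRoot z d := hζ.of_map_of_injective hinjAK
  set c' := algebraMap A K c
  have h0 : ∀ n, (unicrit d c')^[n + 1] 0 ≠ 0 := by
    intro n hn
    rw [← map_zero (algebraMap A K), ← map_iterate_unicrit] at hn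
    exact iterate_unicrit_zero_ne_zero hd hc hc0 n (hinjAK hn)
  have hdK : (d : K) ≠ 0 := by
    simpa using ((hdA.map (algebraMap A K)).ne_zero)
  by_contra! hbad
  have hinf := Nat.frequently_atTop_iff_infinite.1 (Filter.frequently_atTop.2 hbad)
  obtain ⟨t, htbad, htcard⟩ := hinf.exists_subset_card_eq ν
  set n := t.sup id + 1
  set p := iter (X ^ d + C c') n with hp
  have hpsep : p.Separable := separable_iter hdK c' h0 n
  let L := IntermediateField.adjoin K (p.rootSet (AlgebraicClosure K))
  have hsplit : IsSplittingField K L p :=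
    IntermediateField.adjoin_rootSet_isSplittingField (IsAlgClosed.splits _)
  have hgal : IsGalois K L := IsGalois.of_separable_splitting_field hpsep
  have hfin : FiniteDimensional K L := IsSplittingField.finiteDimensional L p
  have hroot : ∀ x : AlgebraicClosure K, (unicrit d (algebraMap K _ c'))^[n] x = 0 → x ∈ L :=
    fun x hx => IntermediateField.subset_adjoin _ _
      (mem_rootSet.2 ⟨hpsep.ne_zero, by rw [hp, aeval_iter, hx]⟩)
  have hroot' : ∀ j ≤ n, ∀ x : AlgebraicClosure K,
      (unicrit d (algebraMap K _ c'))^[j] x = 0 → x ∈ L := by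
    intro j hj x hx
    obtain ⟨y, rfl⟩ := exists_iterate_unicrit_eq hd0 (algebraMap K (AlgebraicClosure K) c')
      (n - j) x
    rw [← Function.iterate_add_apply, Nat.add_sub_cancel' hj] at hx
    exact iterate_unicrit_mem L (hroot y hx)
  let : Algebra A L := ((algebraMap K L).comp (algebraMap A K)).toAlgebra
  have : IsScalarTower A K L := IsScalarTower.of_algebraMap_eq fun _ => rfl
  have : FaithfulSMul A L := by
    rw [faithfulSMul_iff_algebraMap_injective, IsScalarTower.algebraMap_eq A K L]
    exact (algebraMap K L).injective.comp hinjAK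
  have : IsFractionRing (integralClosure A L) L :=
    integralClosure.isFractionRing_of_finite_extension K L
  have : IsDedekindDomain (integralClosure A L) := integralClosure.isDedekindDomain A K L
  have : Module.Finite A (integralClosure A L) := IsIntegralClosure.finite A K L _
  have : IsGaloisGroup Gal(L/K) A (integralClosure A L) := .of_isFractionRing _ A _ K L
  let ι : integralClosure A L →+* AlgebraicClosure K :=
    (algebraMap L (AlgebraicClosure K)).comp (algebraMap (integralClosure A L) L)
  have hι : Function.Injective ι :=
    (algebraMap L (AlgebraicClosure K)).injective.comp Subtype.val_injective
  have hιA : ∀ a : A, ι (algebraMap A _ a) = algebraMap K (AlgebraicClosure K) (algebraMap A K a) :=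
    fun a => rfl
  have hιroot : ∀ j x, (unicrit d (algebraMap A (integralClosure A L) c))^[j] x = 0 ↔
      (unicrit d (algebraMap K (AlgebraicClosure K) c'))^[j] (ι x) = 0 := by
    intro j x
    rw [← map_eq_zero_iff ι hι, map_iterate_unicrit, hιA]
  have hlift : ∀ j ≤ n, ∀ x : AlgebraicClosure K,
      (unicrit d (algebraMap K _ c'))^[j] x = 0 → ∃ y, ι y = x := by
    intro j hj x hx
    have hxL := hroot' j hj x hx
    refine ⟨⟨⟨x, hxL⟩, isIntegral_of_iterate_unicrit hd0 c (n := j) ?_⟩, rfl⟩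
    have : (unicrit d (algebraMap A L c))^[j] ⟨x, hxL⟩ = 0 := by
      refine (algebraMap L (AlgebraicClosure K)).injective ?_
      rw [map_iterate_unicrit, map_zero]
      exact hx
    rw [this]
    exact isIntegral_zero
  obtain ⟨x₀, hx₀⟩ := exists_iterate_unicrit_eq hd0 (algebraMap K (AlgebraicClosure K) c') n 0
  obtain ⟨y₀, rfl⟩ := hlift n le_rfl x₀ hx₀
  have hfaith : ∀ σ : Gal(L/K), (∀ x, (unicrit d (algebraMap A (integralClosure A L) c))^[n] x = 0 →
      σ • x = x) → σ = 1 := by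
    intro σ hσ
    have : (σ : L →ₐ[K] L) = AlgHom.id K L := by
      refine IntermediateField.algHom_ext_of_eq_adjoin K rfl fun x hx => ?_
      have hx0 : (unicrit d (algebraMap K _ c'))^[n] x = 0 := by
        rw [← aeval_iter]
        exact (mem_rootSet.1 hx).2
      obtain ⟨y, hy⟩ := hlift n le_rfl x hx0
      have h1 := hσ y ((hιroot n y).2 (hy ▸ hx0))
      have h2 : (y : L) = ⟨x, IntermediateField.subset_adjoin _ _ hx⟩ := Subtype.ext hy
      rw [← h2]
      exact congrArg Subtype.val h1
    exact AlgEquiv.ext fun x => DFunLike.congr_fun this x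
  refine absurd (two_pow_card_le_of_unicrit (G := Gal(L/K)) hd hdA hz hϖ hν0 hν
    ((hιroot n y₀).2 hx₀) hfaith t fun i hi => ⟨?_, ?_⟩) (htcard ▸ Nat.lt_two_pow_self.not_ge)
  · exact Nat.lt_succ_of_le (Finset.le_sup (f := id) hi)
  · have hin : i + 1 ≤ n := Nat.succ_le_succ (Finset.le_sup (f := id) hi)
    rintro ⟨σ, hσ1, hσ2⟩
    have hcomm : ∀ y : integralClosure A L,
        σ.liftNormal (AlgebraicClosure K) (ι y) = ι (σ • y) :=
      fun y => AlgEquiv.liftNormal_commutes σ (AlgebraicClosure K) (y : L)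
    obtain ⟨x, hx, hne⟩ := htbad hi (σ.liftNormal (AlgebraicClosure K)) (by
      intro j hj x hx
      obtain ⟨y, rfl⟩ := hlift j (by omega) x hx
      rw [hcomm, hσ1 j hj y ((hιroot j y).2 hx)])
    obtain ⟨y, rfl⟩ := hlift _ hin x hx
    rw [hcomm, hσ2 y ((hιroot _ y).2 hx), map_mul, hιA] at hne
    exact hne rfl

/-- A process on a group is a martingale if at each step some group element `h` preserves the past
and the average of the next value over the powers of `h` is the present value. -/
theorem isMartingaleProcess_of_average {Ω : Type*} [Group Ω] [MeasurableSpace Ω] [MeasurableMul Ω]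
    (μ : Measure Ω) [μ.IsMulLeftInvariant] [IsProbabilityMeasure μ] (Y : ℕ → Ω → ℝ)
    (hmeas : ∀ n, Measurable (Y n)) (hint : ∀ n, Integrable (Y n) μ)
    (h : ∀ n, 1 ≤ n → ∃ k : ℕ, k ≠ 0 ∧ ∃ g : Ω, (∀ i ≤ n, ∀ s, Y i (g * s) = Y i s) ∧
      ∀ s, ∑ j ∈ Finset.range k, Y (n + 1) (g ^ j * s) = k * Y n s) :
    IsMartingaleProcess μ Y := by
  refine ⟨fun n _ => hint n, fun n hn t ht => ?_⟩
  set E := {ω | ∀ i, 1 ≤ i → i ≤ n → Y i ω = t i} with hE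
  have hEm : MeasurableSet E := by
    have : E = ⋂ i, ⋂ (_ : 1 ≤ i), ⋂ (_ : i ≤ n), Y i ⁻¹' {t i} := by
      ext ω; simp [hE]
    rw [this]
    exact MeasurableSet.iInter fun i => MeasurableSet.iInter fun _ => MeasurableSet.iInter fun _ =>
      hmeas i (measurableSet_singleton _)
  obtain ⟨k, hk, g, hpast, havg⟩ := h n hn
  have hpast' : ∀ j, ∀ i ≤ n, ∀ s, Y i (g ^ j * s) = Y i s := by
    intro j i hi
    induction j with
    | zero => simp
    | succ j ih => intro s; rw [pow_succ', mul_assoc, hpast i hi, ih]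
  have hinv : ∀ j s, E.indicator (Y (n + 1)) (g ^ j * s) =
      E.indicator (fun s => Y (n + 1) (g ^ j * s)) s := by
    intro j s
    have : g ^ j * s ∈ E ↔ s ∈ E := by
      simp only [hE, Set.mem_ofPred_eq]
      exact forall_congr' fun i => forall_congr' fun _ => forall_congr' fun hi => by
        rw [hpast' j i hi]
    by_cases hs : s ∈ E
    · rw [Set.indicator_of_mem hs, Set.indicator_of_mem (this.2 hs)]
    · rw [Set.indicator_of_notMem hs, Set.indicator_of_notMem (mt this.1 hs)]
  have hshift : ∀ j, ∫ s in E, Y (n + 1) (g ^ j * s) ∂μ = ∫ s in E, Y (n + 1) s ∂μ := by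
    intro j
    rw [← integral_indicator hEm, ← integral_indicator hEm,
      ← integral_mul_left_eq_self (E.indicator (Y (n + 1))) (g ^ j)]
    simp only [hinv]
  have hsum : (k : ℝ) * ∫ s in E, Y n s ∂μ = k * ∫ s in E, Y (n + 1) s ∂μ := by
    rw [← integral_const_mul]
    simp only [← havg]
    rw [integral_finsetSum _ fun j _ => ((hint (n + 1)).comp_mul_left (g ^ j)).integrableOn]
    simp [hshift]
  have heq := mul_left_cancel₀ (Nat.cast_ne_zero.2 hk) hsum
  have hconst : ∫ s in E, Y n s ∂μ = μ.real E * t n := by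
    rw [setIntegral_congr_fun hEm (g := fun _ => t n) fun s hs => hs n hn le_rfl]
    simp
  have hμE : μ.real E ≠ 0 := by
    rw [measureReal_ne_zero_iff]
    exact ht.ne'
  rw [ProbabilityTheory.cond, integral_smul_measure, ← heq, hconst, ENNReal.toReal_inv, smul_eq_mul]
  exact inv_mul_cancel_left₀ hμE _

namespace GaloisProcess

variable {K : Type*} [Field K]

instance (f g : K[X]) (n : ℕ) : Normal K (splitField f g n) :=
  have : IsSplittingField K (splitField f g n) (g.comp (iter f n)) :=
    IntermediateField.adjoin_rootSet_isSplittingField (IsAlgClosed.splits _)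
  Normal.of_isSplittingField (g.comp (iter f n))

/-- The element of `G_∞` defined by an automorphism of the algebraic closure. -/
noncomputable def restrictGal (f g : K[X]) (σ : Gal(AlgebraicClosure K/K)) : galLimit f g :=
  ⟨fun n => σ.restrictNormal (splitField f g n), fun m n _ x y hxy => by
    have h1 := σ.restrictNormal_commutes (splitField f g m) x
    have h2 := σ.restrictNormal_commutes (splitField f g n) y
    exact h1.trans ((congrArg σ hxy).trans h2.symm)⟩

theorem coe_restrictGal_apply (f g : K[X]) (σ : Gal(AlgebraicClosure K/K)) (n : ℕ)
    (x : splitField f g n) :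
    (((restrictGal f g σ).1 n x : splitField f g n) : AlgebraicClosure K) = σ x :=
  σ.restrictNormal_commutes (splitField f g n) x

theorem coe_restrictGal_pow_mul_apply (f g : K[X]) (σ : Gal(AlgebraicClosure K/K)) (j : ℕ)
    (s : galLimit f g) (n : ℕ) (x : splitField f g n) :
    (((restrictGal f g σ ^ j * s).1 n x : splitField f g n) : AlgebraicClosure K) =
      (σ ^ j) (s.1 n x : splitField f g n) := by
  induction j with
  | zero => simp
  | succ j ih =>
    rw [pow_succ', pow_succ', mul_assoc, AlgEquiv.mul_apply, ← ih, ← coe_restrictGal_apply f g σ n]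
    rfl

theorem continuous_process (f g : K[X]) (n : ℕ) : Continuous (process f g n) := by
  have h1 : Continuous fun σ : galLimit f g => σ.1 n :=
    (continuous_apply n).comp continuous_subtype_val
  have h2 : Continuous fun τ : galGroup f g n => ({β : splitField f g n |
      (β : AlgebraicClosure K) ∈ rootsAt f g n ∧ τ β = β}.ncard : ℝ) :=
    continuous_of_discreteTopology
  exact h2.comp h1

theorem process_eq_ncard {f g : K[X]} {n : ℕ} {s : galLimit f g}
    {t : AlgebraicClosure K → AlgebraicClosure K}
    (h : ∀ x : splitField f g n, ((s.1 n x : splitField f g n) : AlgebraicClosure K) = t x) :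
    process f g n s = ({β ∈ rootsAt f g n | t β = β}.ncard : ℝ) := by
  have : ((↑) : splitField f g n → AlgebraicClosure K) ''
      {β | (β : AlgebraicClosure K) ∈ rootsAt f g n ∧ s.1 n β = β} =
      {β ∈ rootsAt f g n | t β = β} := by
    ext β
    constructor
    · rintro ⟨β, ⟨h1, h2⟩, rfl⟩
      exact ⟨h1, by rw [← h, h2]⟩
    · rintro ⟨h1, h2⟩
      exact ⟨⟨β, IntermediateField.subset_adjoin _ _ h1⟩, ⟨h1, Subtype.ext (by rw [h, h2])⟩, rfl⟩
  rw [process, ← this, Set.ncard_image_of_injective _ Subtype.val_injective]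

theorem finite_rootsAt (f g : K[X]) (n : ℕ) : (rootsAt f g n).Finite :=
  Polynomial.rootSet_finite _ _

theorem norm_process_le (f g : K[X]) (n : ℕ) (s : galLimit f g) :
    ‖process f g n s‖ ≤ (rootsAt f g n).ncard := by
  have h := process_eq_ncard (s := s) (n := n) (t := (s.1 n).liftNormal (AlgebraicClosure K))
    fun x => ((s.1 n).liftNormal_commutes _ x).symm
  rw [h, Real.norm_natCast, Nat.cast_le]
  exact Set.ncard_le_ncard (fun _ hx => hx.1) (finite_rootsAt f g n)

theorem integrable_process (f g : K[X]) [MeasurableSpace (galLimit f g)] [BorelSpace (galLimit f g)]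
    (μ : Measure (galLimit f g)) [IsFiniteMeasure μ] (n : ℕ) : Integrable (process f g n) μ :=
  .of_bound (continuous_process f g n).measurable.aestronglyMeasurable _
    (Filter.Eventually.of_forall (norm_process_le f g n))

theorem natDegree_iter (d : ℕ) (c : K) (n : ℕ) :
    (iter (X ^ d + C c) n).natDegree = d ^ n := by
  induction n with
  | zero => simp [iter]
  | succ n ih => rw [iter_succ, natDegree_comp, ih, natDegree_X_pow_add_C, pow_succ']

theorem iter_ne_zero {d : ℕ} (hd : d ≠ 0) (c : K) (n : ℕ) : iter (X ^ d + C c) n ≠ 0 := by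
  intro h
  have := natDegree_iter d c n
  rw [h, natDegree_zero] at this
  exact pow_ne_zero n hd this.symm

theorem mem_rootsAt {d : ℕ} (hd : d ≠ 0) {c : K} {g : K[X]} (hg : g ≠ 0) {n : ℕ}
    {x : AlgebraicClosure K} : x ∈ rootsAt (X ^ d + C c) g n ↔
      aeval ((unicrit d (algebraMap K (AlgebraicClosure K) c))^[n] x) g = 0 := by
  rw [rootsAt, mem_rootSet, aeval_comp, aeval_iter, and_iff_right]
  intro h
  rcases comp_eq_zero_iff.1 h with h | ⟨-, h⟩
  · exact hg h
  · have := natDegree_iter d c n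
    rw [h, natDegree_C] at this
    exact pow_ne_zero n hd this.symm

theorem iterate_eq_zero_of_mem_rootsAt {d : ℕ} (hd : d ≠ 0) {c : K} {g : K[X]} (hg : g ≠ 0)
    {m : ℕ} (hgm : g ∣ iter (X ^ d + C c) m) {n : ℕ} {x : AlgebraicClosure K}
    (hx : x ∈ rootsAt (X ^ d + C c) g n) :
    (unicrit d (algebraMap K (AlgebraicClosure K) c))^[n + m] x = 0 := by
  rw [add_comm, Function.iterate_add_apply, ← aeval_iter]
  exact aeval_eq_zero_of_dvd_aeval_eq_zero hgm ((mem_rootsAt hd hg).1 hx)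

theorem unicrit_mem_rootsAt_iff {d : ℕ} (hd : d ≠ 0) {c : K} {g : K[X]} (hg : g ≠ 0) {n : ℕ}
    {x : AlgebraicClosure K} : unicrit d (algebraMap K (AlgebraicClosure K) c) x ∈
      rootsAt (X ^ d + C c) g n ↔ x ∈ rootsAt (X ^ d + C c) g (n + 1) := by
  rw [mem_rootsAt hd hg, mem_rootsAt hd hg, Function.iterate_succ_apply]

theorem gal_mem_rootsAt {f g : K[X]} {n : ℕ} {x : AlgebraicClosure K}
    (t : Gal(AlgebraicClosure K/K)) (hx : x ∈ rootsAt f g n) : t x ∈ rootsAt f g n := by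
  rw [rootsAt, mem_rootSet] at hx ⊢
  exact ⟨hx.1, by rw [aeval_algEquiv, AlgHom.comp_apply, hx.2]; exact map_zero t⟩

theorem gal_unicrit {d : ℕ} {c : K} (t : Gal(AlgebraicClosure K/K)) (x : AlgebraicClosure K) :
    t (unicrit d (algebraMap K (AlgebraicClosure K) c) x) =
      unicrit d (algebraMap K (AlgebraicClosure K) c) (t x) := by
  simp [unicrit]

theorem splitField_le_succ {d : ℕ} (hd : d ≠ 0) {c : K} {g : K[X]} (hg : g ≠ 0) (n : ℕ) :
    splitField (X ^ d + C c) g n ≤ splitField (X ^ d + C c) g (n + 1) := by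
  refine IntermediateField.adjoin_le_iff.2 fun x hx => ?_
  obtain ⟨y, rfl⟩ := exists_iterate_unicrit_eq hd (algebraMap K (AlgebraicClosure K) c) 1 x
  exact iterate_unicrit_mem (n := 1) _ (IntermediateField.subset_adjoin _ _
    ((unicrit_mem_rootsAt_iff hd hg).1 hx))

end GaloisProcess

/-- The number of preimages of a point under `x ↦ x ^ d + c`. -/
theorem card_filter_unicrit_eq {L : Type*} [Field L] [IsAlgClosed L] [DecidableEq L] {d : ℕ}
    [NeZero d] {ζ : L} (hζ : IsPrimitiveRoot ζ d) {c α : L} (hα : α ≠ c) (s : Finset L)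
    (hs : ∀ x, unicrit d c x = α → x ∈ s) : (s.filter fun x => unicrit d c x = α).card = d := by
  obtain ⟨x₀, hx₀⟩ := IsAlgClosed.exists_pow_nat_eq (α - c) (NeZero.pos d)
  have h0 : α - c ≠ 0 := sub_ne_zero.2 hα
  have : s.filter (fun x => unicrit d c x = α) = (nthRoots d (α - c)).toFinset := by
    ext x
    rw [Finset.mem_filter, Multiset.mem_toFinset, mem_nthRoots (NeZero.pos d), eq_sub_iff_add_eq]
    exact ⟨fun h => h.2, fun h => ⟨hs x h, h⟩⟩
  rw [this, Multiset.toFinset_card_of_nodup (hζ.nthRoots_nodup h0), hζ.card_nthRoots, if_pos ⟨x₀, hx₀⟩]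

/-- Exactly one `j < d` satisfies `ζ ^ (k + j) = 1`. -/
theorem IsPrimitiveRoot.card_filter_pow_add_eq_one {M : Type*} [CommMonoid M] [DecidableEq M]
    {ζ : M} {d : ℕ} (hζ : IsPrimitiveRoot ζ d) (hd : d ≠ 0) (k : ℕ) :
    ((Finset.range d).filter fun j => ζ ^ (k + j) = 1).card = 1 := by
  have hd' := Nat.pos_of_ne_zero hd
  rw [Finset.card_eq_one]
  refine ⟨(d - k % d) % d, ?_⟩
  ext j
  rw [Finset.mem_filter, Finset.mem_range, Finset.mem_singleton, hζ.pow_eq_one_iff_dvd]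
  have hk := Nat.mod_lt k hd'
  have hkd := Nat.mod_add_div k d
  constructor
  · rintro ⟨hj, hdvd⟩
    have h1 : d ∣ k % d + j := by
      rw [← Nat.dvd_add_left (dvd_mul_right d (k / d))]
      convert hdvd using 1
      omega
    rcases Nat.eq_zero_or_pos (k % d) with h | h
    · rw [h, zero_add] at h1
      rw [h, Nat.sub_zero, Nat.mod_self]
      exact Nat.eq_zero_of_dvd_of_lt h1 hj
    · obtain ⟨q, hq⟩ := h1
      have hq1 : q = 1 := by
        rcases q with _ | _ | q
        · omega
        · rfl
        · nlinarith
      rw [Nat.mod_eq_of_lt (by omega)]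
      rw [hq1] at hq
      omega
  · rintro rfl
    refine ⟨Nat.mod_lt _ hd', ?_⟩
    rcases Nat.eq_zero_or_pos (k % d) with h | h
    · rw [h, Nat.sub_zero, Nat.mod_self, add_zero]
      exact Nat.dvd_of_mod_eq_zero h
    · rw [Nat.mod_eq_of_lt (by omega)]
      exact ⟨k / d + 1, by rw [mul_add, mul_one]; omega⟩

namespace GaloisProcess

variable {K : Type*} [Field K]

open Classical in
/-- The average number of fixed points of `σ ^ j t` on `T_{n+1}` is the number of fixed points of
`t` on `T_n`. -/
theorem sum_ncard_fixed_eq {d : ℕ} (hd : d ≠ 0) {ζ : K} (hζ : IsPrimitiveRoot ζ d) {c : K}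
    {g : K[X]} (hg : g ≠ 0) {n : ℕ} (σ t : Gal(AlgebraicClosure K/K))
    (hfix : ∀ x ∈ rootsAt (X ^ d + C c) g n, σ x = x)
    (hrot : ∀ x ∈ rootsAt (X ^ d + C c) g (n + 1), σ x = algebraMap K (AlgebraicClosure K) ζ * x)
    (h0 : 0 ∉ rootsAt (X ^ d + C c) g (n + 1)) :
    ∑ j ∈ Finset.range d, {x ∈ rootsAt (X ^ d + C c) g (n + 1) | (σ ^ j) (t x) = x}.ncard =
      d * {x ∈ rootsAt (X ^ d + C c) g n | t x = x}.ncard := by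
  have : NeZero d := ⟨hd⟩
  set F := unicrit d (algebraMap K (AlgebraicClosure K) c) with hF
  set ζ' := algebraMap K (AlgebraicClosure K) ζ
  have hζ' : IsPrimitiveRoot ζ' d := hζ.map_of_injective (algebraMap K _).injective
  let T := (finite_rootsAt (X ^ d + C c) g n).toFinset
  let T' := (finite_rootsAt (X ^ d + C c) g (n + 1)).toFinset
  have hT : ∀ x, x ∈ T ↔ x ∈ rootsAt (X ^ d + C c) g n := fun x => Set.Finite.mem_toFinset _
  have hT' : ∀ x, x ∈ T' ↔ x ∈ rootsAt (X ^ d + C c) g (n + 1) := fun x => Set.Finite.mem_toFinset _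
  have hcard : ∀ j, {x ∈ rootsAt (X ^ d + C c) g (n + 1) | (σ ^ j) (t x) = x}.ncard =
      (T'.filter fun x => (σ ^ j) (t x) = x).card := fun j => by
    rw [← Set.ncard_coe_finset]
    congr 1; ext x; simp [hT']
  have hcard0 : {x ∈ rootsAt (X ^ d + C c) g n | t x = x}.ncard =
      (T.filter fun x => t x = x).card := by
    rw [← Set.ncard_coe_finset]
    congr 1; ext x; simp [hT]
  have hfixpow : ∀ j, ∀ x ∈ rootsAt (X ^ d + C c) g n, (σ ^ j) x = x := by
    intro j x hx
    induction j with
    | zero => simp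
    | succ j ih => rw [pow_succ', AlgEquiv.mul_apply, ih, hfix x hx]
  have hrotpow : ∀ j, ∀ x ∈ rootsAt (X ^ d + C c) g (n + 1), (σ ^ j) x = ζ' ^ j * x := by
    intro j x hx
    induction j with
    | zero => simp
    | succ j ih =>
      rw [pow_succ', AlgEquiv.mul_apply, ih, map_mul, map_pow, AlgEquiv.commutes, hrot x hx, pow_succ,
        mul_assoc]
  have hpoint : ∀ x ∈ T', ((Finset.range d).filter fun j => (σ ^ j) (t x) = x).card =
      if t (F x) = F x then 1 else 0 := by
    intro x hx
    have hxT := (hT' x).1 hx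
    have hFx : F x ∈ rootsAt (X ^ d + C c) g n := (unicrit_mem_rootsAt_iff hd hg).2 hxT
    have hx0 : x ≠ 0 := fun h => h0 (h ▸ hxT)
    split_ifs with htF
    · have hpow : (t x) ^ d = x ^ d := by
        rw [hF, gal_unicrit] at htF
        exact add_right_cancel htF
      obtain ⟨k, hk⟩ := hζ'.exists_eq_pow_mul_of_pow_eq_pow hx0 hpow
      rw [← hζ'.card_filter_pow_add_eq_one hd k]
      congr 1
      refine Finset.filter_congr fun j _ => ?_
      rw [hrotpow j _ (gal_mem_rootsAt t hxT), hk, ← mul_assoc, ← pow_add, add_comm j,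
        mul_eq_right₀ hx0]
    · rw [Finset.card_eq_zero, Finset.filter_eq_empty_iff]
      intro j _ hj
      refine htF ?_
      rw [← hfixpow j _ (gal_mem_rootsAt t hFx), hF, gal_unicrit, gal_unicrit, hj]
  have hfib : ∀ y ∈ T, (T'.filter fun x => F x = y).card = d := by
    intro y hy
    refine card_filter_unicrit_eq hζ' ?_ _ fun x hx => ?_
    · rintro rfl
      refine h0 ((unicrit_mem_rootsAt_iff hd hg).1 ?_)
      simpa [unicrit, zero_pow hd] using (hT _).1 hy
    · rw [hT', ← unicrit_mem_rootsAt_iff hd hg, hx]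
      exact (hT y).1 hy
  calc _ = ∑ j ∈ Finset.range d, ∑ x ∈ T', if (σ ^ j) (t x) = x then 1 else 0 := by
        simp only [hcard, Finset.card_filter]
    _ = ∑ x ∈ T', if t (F x) = F x then 1 else 0 := by
        rw [Finset.sum_comm]
        refine Finset.sum_congr rfl fun x hx => ?_
        rw [← hpoint x hx, Finset.card_filter]
    _ = ∑ y ∈ T, ∑ x ∈ T' with F x = y, if t (F x) = F x then 1 else 0 :=
        (Finset.sum_fiberwise_of_maps_to (fun x hx => (hT _).2
          ((unicrit_mem_rootsAt_iff hd hg).2 ((hT' x).1 hx))) _).symm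
    _ = ∑ y ∈ T, d * if t y = y then 1 else 0 := by
        refine Finset.sum_congr rfl fun y hy => ?_
        rw [Finset.sum_congr rfl (g := fun _ => if t y = y then 1 else 0)
          fun x hx => by rw [(Finset.mem_filter.1 hx).2], Finset.sum_const, hfib y hy, smul_eq_mul]
    _ = _ := by rw [← Finset.mul_sum, ← Finset.card_filter, hcard0]

theorem process_restrictGal_mul {f g : K[X]} {n : ℕ} {σ : Gal(AlgebraicClosure K/K)}
    (hfix : ∀ x ∈ rootsAt f g n, σ x = x) (s : galLimit f g) :
    process f g n (restrictGal f g σ * s) = process f g n s := by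
  have h (x : splitField f g n) : (((restrictGal f g σ * s).1 n x : splitField f g n) :
      AlgebraicClosure K) = σ (s.1 n x : splitField f g n) :=
    coe_restrictGal_apply f g σ n _
  have hσ : (restrictGal f g σ).1 n = 1 := by
    have : (((restrictGal f g σ).1 n : galGroup f g n) : splitField f g n →ₐ[K] splitField f g n) =
        AlgHom.id K _ :=
      IntermediateField.algHom_ext_of_eq_adjoin K rfl fun x hx => Subtype.ext
        ((coe_restrictGal_apply f g σ n _).trans (hfix x hx))
    exact AlgEquiv.ext fun x => DFunLike.congr_fun this x
  simp only [process, Subgroup.coe_mul, Pi.mul_apply, hσ, one_mul]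

theorem sum_process_restrictGal_pow_mul {d : ℕ} (hd : d ≠ 0) {ζ : K} (hζ : IsPrimitiveRoot ζ d)
    {c : K} {g : K[X]} (hg : g ≠ 0) {n : ℕ} (σ : Gal(AlgebraicClosure K/K))
    (hfix : ∀ x ∈ rootsAt (X ^ d + C c) g n, σ x = x)
    (hrot : ∀ x ∈ rootsAt (X ^ d + C c) g (n + 1), σ x = algebraMap K (AlgebraicClosure K) ζ * x)
    (h0 : 0 ∉ rootsAt (X ^ d + C c) g (n + 1)) (s : galLimit (X ^ d + C c) g) :
    ∑ j ∈ Finset.range d, process (X ^ d + C c) g (n + 1) (restrictGal _ g σ ^ j * s) =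
      d * process (X ^ d + C c) g n s := by
  let t := (s.1 (n + 1)).liftNormal (AlgebraicClosure K)
  have ht1 : ∀ x : splitField (X ^ d + C c) g (n + 1),
      ((s.1 (n + 1) x : splitField (X ^ d + C c) g (n + 1)) : AlgebraicClosure K) = t x :=
    fun x => ((s.1 (n + 1)).liftNormal_commutes _ x).symm
  have ht0 : ∀ x : splitField (X ^ d + C c) g n, ((s.1 n x : splitField (X ^ d + C c) g n) : AlgebraicClosure K) = t x :=
    fun x => (s.2 n (n + 1) (Nat.le_succ n) x ⟨x, splitField_le_succ hd hg n x.2⟩ rfl).trans (ht1 _)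
  rw [process_eq_ncard ht0]
  have : ∀ j, process (X ^ d + C c) g (n + 1) (restrictGal (X ^ d + C c) g σ ^ j * s) =
      ({x ∈ rootsAt (X ^ d + C c) g (n + 1) | (σ ^ j) (t x) = x}.ncard : ℝ) := fun j =>
    process_eq_ncard (t := fun x => (σ ^ j) (t x)) fun x => by
      rw [coe_restrictGal_pow_mul_apply, ht1]
  simp only [this]
  exact_mod_cast sum_ncard_fixed_eq hd hζ hg σ t hfix hrot h0

theorem process_eq_of_subset_zero {f g : K[X]} {n : ℕ} (h : rootsAt f g n ⊆ {0})
    (s : galLimit f g) : process f g n s = (rootsAt f g n).ncard := by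
  rw [process_eq_ncard (t := (s.1 n).liftNormal (AlgebraicClosure K))
    fun x => ((s.1 n).liftNormal_commutes _ x).symm]
  congr 2
  ext x
  refine and_iff_left_of_imp fun hx => ?_
  rw [show x = 0 from h hx, map_zero]

end GaloisProcess

theorem Valuation.isUnit_natCast_of_coprime_residueCharacteristic {K : Type*} [Field K]
    {v : Valuation K NNReal} {d : ℕ} (h : (residueCharacteristic v).Coprime d) :
    IsUnit (d : v.valuationSubring) := by
  by_contra hd
  have h1 : (d : IsLocalRing.ResidueField v.valuationSubring) = 0 := by
    rw [← map_natCast (IsLocalRing.residue v.valuationSubring)]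
    exact (IsLocalRing.residue_eq_zero_iff _).2 ((IsLocalRing.mem_maximalIdeal _).2 hd)
  have h2 : residueCharacteristic v ∣ d := (ringChar.spec _ d).1 h1
  exact CharP.ringChar_ne_one (h.eq_one_of_dvd h2)

open GaloisProcess in
theorem theorem3p3 {K : Type*} [Field K] (hK : IsGlobalField K)
    (d : ℕ) (hd : 2 ≤ d) (hchar : ¬ ringChar K ∣ d) (hζ : ∃ ζ : K, IsPrimitiveRoot ζ d)
    (c : K) (g : K[X]) (hg : ∃ m : ℕ, g ∣ GaloisProcess.iter (X ^ d + C c) m)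
    (hp : ∃ v : Valuation K NNReal, v.IsNontrivial ∧
      (residueCharacteristic v).Coprime d ∧ v c < 1)
    [MeasurableSpace (GaloisProcess.galLimit (X ^ d + C c) g)]
    [BorelSpace (GaloisProcess.galLimit (X ^ d + C c) g)]
    (μ : Measure (GaloisProcess.galLimit (X ^ d + C c) g))
    [μ.IsHaarMeasure] [IsProbabilityMeasure μ] :
    IsEventualMartingaleProcess μ (GaloisProcess.process (X ^ d + C c) g) := by
  obtain ⟨ζ, hζ⟩ := hζ
  obtain ⟨m, hgm⟩ := hg
  obtain ⟨v, hv, hres, hvc⟩ := hp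
  have hd0 : d ≠ 0 := by omega
  have hg0 : g ≠ 0 := fun h => iter_ne_zero hd0 c m (zero_dvd_iff.1 (h ▸ hgm))
  have hmeas := fun n => (continuous_process (X ^ d + C c) g n).measurable
  have hint := fun n => integrable_process (X ^ d + C c) g μ n
  rcases eq_or_ne c 0 with rfl | hc0
  · have hsub : ∀ n, rootsAt (X ^ d + C 0) g n ⊆ {0} := fun n x hx => by
      have h := iterate_eq_zero_of_mem_rootsAt hd0 hg0 hgm hx
      have hF : unicrit d (algebraMap K (AlgebraicClosure K) 0) = fun x => x ^ d := by
        ext x; simp [unicrit]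
      rw [hF, pow_iterate] at h
      exact pow_eq_zero_iff (pow_ne_zero _ hd0) |>.1 h
    have hroots : ∀ n, rootsAt (X ^ d + C 0) g (n + 1) = rootsAt (X ^ d + C 0) g n := fun n => by
      have h0 : (0 : AlgebraicClosure K) ∈ rootsAt (X ^ d + C 0) g n ↔
          0 ∈ rootsAt (X ^ d + C 0) g (n + 1) := by
        rw [← unicrit_mem_rootsAt_iff hd0 hg0]
        simp [unicrit, zero_pow hd0]
      ext x
      constructor <;> intro hx
      · have hx0 : x = 0 := hsub _ hx
        exact hx0 ▸ h0.2 (hx0 ▸ hx)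
      · have hx0 : x = 0 := hsub _ hx
        exact hx0 ▸ h0.1 (hx0 ▸ hx)
    refine ⟨1, le_rfl, isMartingaleProcess_of_average μ _ (fun n => hmeas _) (fun n => hint _)
      fun n _ => ⟨1, one_ne_zero, 1, fun _ _ _ => by rw [one_mul], fun s => ?_⟩⟩
    simp only [Finset.range_one, Finset.sum_singleton, pow_zero, one_mul, Nat.cast_one]
    rw [process_eq_of_subset_zero (hsub _), process_eq_of_subset_zero (hsub _)]
    exact congrArg (fun S => (Set.ncard S : ℝ)) (hroots (1 - 1 + n))
  · have hdvr := hK.isDiscreteValuationRing v hv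
    let cA : v.valuationSubring := ⟨c, hvc.le⟩
    have hcA : cA ∈ IsLocalRing.maximalIdeal v.valuationSubring :=
      (Valuation.mem_maximalIdeal_iff K v).2 hvc
    have hcA0 : cA ≠ 0 := fun h => hc0 (congrArg Subtype.val h)
    have hdA := Valuation.isUnit_natCast_of_coprime_residueCharacteristic hres
    obtain ⟨N, hN⟩ := exists_forall_exists_gal_unicrit hd hdA hζ hcA hcA0
    have hroot0 : ∀ n, 0 ∉ rootsAt (X ^ d + C c) g (n + 1) := fun n hn => by
      have h := iterate_eq_zero_of_mem_rootsAt hd0 hg0 hgm hn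
      have hinj : Function.Injective ((algebraMap K (AlgebraicClosure K)).comp
          (algebraMap v.valuationSubring K)) :=
        (algebraMap K _).injective.comp Subtype.val_injective
      have hmap := map_iterate_unicrit ((algebraMap K (AlgebraicClosure K)).comp
        (algebraMap v.valuationSubring K)) d cA (n + 1 + m) 0
      rw [map_zero] at hmap
      rw [show n + 1 + m = n + m + 1 by ring] at h hmap
      exact iterate_unicrit_zero_ne_zero hd hcA hcA0 (n + m) (hinj (by rw [map_zero]; exact hmap.trans h))
    refine ⟨N + 1, by omega, isMartingaleProcess_of_average μ _ (fun n => hmeas _)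
      (fun n => hint _) fun n hn => ?_⟩
    obtain ⟨σ, hσ1, hσ2⟩ := hN (N + n + m) (by omega)
    have hfix : ∀ i ≤ N + n, ∀ x ∈ rootsAt (X ^ d + C c) g i, σ x = x := fun i hi x hx =>
      hσ1 (i + m) (by omega) x (iterate_eq_zero_of_mem_rootsAt hd0 hg0 hgm hx)
    refine ⟨d, hd0, restrictGal _ g σ, fun i hi s => process_restrictGal_mul (hfix _ (by omega)) s,
      fun s => ?_⟩
    refine sum_process_restrictGal_pow_mul hd0 hζ hg0 (n := N + n) σ (hfix _ le_rfl)
      (fun x hx => hσ2 x ?_) (hroot0 _) s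
    have h := iterate_eq_zero_of_mem_rootsAt hd0 hg0 hgm hx
    rwa [show N + n + 1 + m = N + n + m + 1 by ring] at h
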